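/- There is an absolute constant $C>0$ such that the following holds. Let $1\le k<n$, let $\mathbb{S}^n$ be the space of real symmetric $n\times n$ matrices with the inner product $\langle \mathbf{A},\mathbf{B}\rangle=\mathrm{Tr}(\mathbf{A}\mathbf{B})$ and the Frobenius norm $\|\cdot\|_F$, let $\lambda_i(\cdot)$ denote the $i$-th largest eigenvalue, let $\mathcal{P}_{n,k}=\{\mathbf{Q}\mathbf{Q}^\top : \mathbf{Q}\in\mathbb{R}^{n\times k},\ \mathbf{Q}^\top\mathbf{Q}=\mathbf{I}\}$, and let $\mathcal{F}_{n,k}=\mathrm{conv}(\mathcal{P}_{n,k})$ be the Fantope. Let $\beta>0$ and let $f:\mathbb{S}^n\to\mathbb{R}$ be convex and $\beta$-smooth on $\mathcal{F}_{n,k}$, that is, $f$ is convex on $\mathcal{F}_{n,k}$, differentiable at every point of $\mathcal{F}_{n,k}$, and $\|\nabla f(\mathbf{X})-\nabla f(\mathbf{Y})\|_F\le\beta\|\mathbf{X}-\mathbf{Y}\|_F$ for all $\mathbf{X},\mathbf{Y}\in\mathcal{F}_{n,k}$. Let $\mathbf{X}^*$ be a minimizer of $f$ over $\mathcal{F}_{n,k}$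 such that, for some $\delta>0$, $$\lambda_{n-k}(\nabla f(\mathbf{X}^*))-\lambda_{n-k+1}(\nabla f(\mathbf{X}^*))\ge\delta .$$ Let $\{(\mathbf{X}_t,\mathbf{V}_t)\}_{t\ge1}$ be generated by the Frank–Wolfe method with line search: $\mathbf{X}_1\in\mathcal{F}_{n,k}$ is arbitrary and, for all $t\ge1$, $$\mathbf{V}_t\in\operatorname*{argmin}_{\mathbf{V}\in\mathcal{P}_{n,k}}\mathrm{Tr}(\mathbf{V}\nabla f(\mathbf{X}_t)),\qquad \mathbf{X}_{t+1}=(1-\eta_t)\mathbf{X}_t+\eta_t\mathbf{V}_t,$$ where $\eta_t$ minimizes over $\eta\in[0,1]$ one of the two functions $f((1-\eta)\mathbf{X}_t+\eta\mathbf{V}_t)$ and $f(\mathbf{X}_t)+\eta\langle\mathbf{V}_t-\mathbf{X}_t,\nabla f(\mathbf{X}_t)\rangle+\frac{\eta^2\beta}{2}\|\mathbf{V}_t-\mathbf{X}_t\|_F^2$. Then: 1. There is an integer $T_0\ge 0$ with $T_0\le C\,k(\beta/\delta)^3$ such that, for all $t\ge1$ with $t\ge T_0$, $$f(\mathbf{X}_{t+1})-f(\mathbf{X}^*)\le\big(f(\mathbf{X}_t)-f(\mathbf{X}^*)\big)\Big(1-\min\Big\{\frac{\delta}{12\beta},\frac12\Big\}\Big).$$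 2. For all $t\ge1$, the matrix $\mathbf{V}_t$ has rank $k$ and $$\|\mathbf{V}_t-\mathbf{X}^*\|_F^2\le C\,\frac{\beta^2}{\delta^3}\big(f(\mathbf{X}_t)-f(\mathbf{X}^*)\big).$$ -/

import Mathlib

noncomputable section

namespace FantopeFW

open Matrix

/-- The subspace of symmetric matrices in `ℝ^{n×n}`. -/
def symSubmodule (n : ℕ) : Submodule ℝ (Matrix (Fin n) (Fin n) ℝ) where
  carrier := {A | Aᵀ = A}
  add_mem' := by
    intro A B hA hB
    change (A + B)ᵀ = A + B
    rw [Matrix.transpose_add, show Aᵀ = A from hA, show Bᵀ = B from hB]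
  zero_mem' := Matrix.transpose_zero
  smul_mem' := by
    intro c A hA
    change (c • A)ᵀ = c • A
    rw [Matrix.transpose_smul, show Aᵀ = A from hA]

/-- The space `𝕊ⁿ` of real symmetric `n × n` matrices. It is a type of its own, so that its norm
is the one of the inner product defined below. -/
def SymMat (n : ℕ) : Type := symSubmodule n

namespace SymMat

variable {n : ℕ}

/-- The underlying matrix. -/
def toMat (A : SymMat n) : Matrix (Fin n) (Fin n) ℝ := A.1

theorem transpose_toMat (A : SymMat n) : A.toMatᵀ = A.toMat := A.2

theorem isHermitian (A : SymMat n) : A.toMat.IsHermitian := by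
  change (A.toMat)ᴴ = A.toMat
  rw [Matrix.conjTranspose_eq_transpose_of_trivial]
  exact A.transpose_toMat

instance : AddCommGroup (SymMat n) := inferInstanceAs (AddCommGroup (symSubmodule n))

instance : Module ℝ (SymMat n) := inferInstanceAs (Module ℝ (symSubmodule n))

instance : FiniteDimensional ℝ (SymMat n) :=
  inferInstanceAs (FiniteDimensional ℝ (symSubmodule n))

theorem toMat_add (A B : SymMat n) : (A + B).toMat = A.toMat + B.toMat := rfl

theorem toMat_smul (c : ℝ) (A : SymMat n) : (c • A).toMat = c • A.toMat := rfl

theorem toMat_injective : Function.Injective (toMat (n := n)) := Subtype.val_injective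

/-- `Tr(A²)` is the sum of the squares of the entries of a symmetric matrix `A`. -/
theorem trace_mul_self (A : SymMat n) :
    (A.toMat * A.toMat).trace = ∑ i, ∑ j, A.toMat i j ^ 2 := by
  simp only [Matrix.trace, Matrix.diag, Matrix.mul_apply]
  refine Finset.sum_congr rfl fun i _ => Finset.sum_congr rfl fun j _ => ?_
  have h : A.toMat j i = A.toMat i j := congrFun (congrFun A.transpose_toMat i) j
  rw [h, sq]

/-- The standard inner product `⟨A, B⟩ = Tr(A B)` of `𝕊ⁿ`; its norm is the Frobenius norm. -/
@[reducible]
def innerCore (n : ℕ) : InnerProductSpace.Core ℝ (SymMat n) where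
  inner A B := (A.toMat * B.toMat).trace
  conj_inner_symm A B := Matrix.trace_mul_comm B.toMat A.toMat
  re_inner_nonneg A := by
    change 0 ≤ (A.toMat * A.toMat).trace
    rw [trace_mul_self]
    positivity
  add_left A B C := by
    change ((A.toMat + B.toMat) * C.toMat).trace = _
    rw [Matrix.add_mul, Matrix.trace_add]
  smul_left A B r := by
    change ((r • A.toMat) * B.toMat).trace = r * (A.toMat * B.toMat).trace
    rw [Matrix.smul_mul, Matrix.trace_smul, smul_eq_mul]
  definite A h := by
    replace h : (A.toMat * A.toMat).trace = 0 := h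
    rw [trace_mul_self] at h
    apply toMat_injective
    ext i j
    have h1 := (Finset.sum_eq_zero_iff_of_nonneg
      (fun i _ => Finset.sum_nonneg fun j _ => sq_nonneg (A.toMat i j))).1 h i (Finset.mem_univ i)
    have h2 := (Finset.sum_eq_zero_iff_of_nonneg
      (fun j _ => sq_nonneg (A.toMat i j))).1 h1 j (Finset.mem_univ j)
    exact pow_eq_zero_iff (two_ne_zero) |>.1 h2

instance : NormedAddCommGroup (SymMat n) := (innerCore n).toNormedAddCommGroup

instance : InnerProductSpace ℝ (SymMat n) := InnerProductSpace.ofCore (innerCore n).toCore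

instance : CompleteSpace (SymMat n) := FiniteDimensional.complete ℝ (SymMat n)

theorem inner_eq_trace (A B : SymMat n) : inner ℝ A B = (A.toMat * B.toMat).trace := rfl

theorem norm_sq_eq_sum (A : SymMat n) : ‖A‖ ^ 2 = ∑ i, ∑ j, A.toMat i j ^ 2 := by
  rw [← real_inner_self_eq_norm_sq, inner_eq_trace, trace_mul_self]

/-- `λ_i(A)`: the `i`-th largest eigenvalue of `A`, for `1 ≤ i ≤ n` (counted with multiplicity). -/
def eig (A : SymMat n) (i : ℕ) : ℝ :=
  if h : 1 ≤ i ∧ i ≤ n then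
    A.isHermitian.eigenvalues₀ ⟨i - 1, by rw [Fintype.card_fin]; omega⟩
  else 0

end SymMat

/-- `𝒫_{n,k}`: the matrices `Q Qᵀ`, where `Q ∈ ℝ^{n×k}` has orthonormal columns, that is, the
orthogonal projections of `ℝⁿ` onto the `k`-dimensional subspaces. -/
def projSet (n k : ℕ) : Set (SymMat n) :=
  {X | ∃ Q : Matrix (Fin n) (Fin k) ℝ, Qᵀ * Q = 1 ∧ X.toMat = Q * Qᵀ}

/-- The Fantope `ℱ_{n,k} = conv(𝒫_{n,k})`. -/
def fantope (n k : ℕ) : Set (SymMat n) := convexHull ℝ (projSet n k)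

/-- `f` is convex and `β`-smooth on `S`: it is convex on `S`, differentiable at every point of `S`,
and its gradient is `β`-Lipschitz on `S`, all with respect to the Frobenius norm. -/
structure ConvexSmoothOn {n : ℕ} (f : SymMat n → ℝ) (S : Set (SymMat n)) (β : ℝ) : Prop where
  convexOn : ConvexOn ℝ S f
  differentiableAt : ∀ X ∈ S, DifferentiableAt ℝ f X
  lipschitz : ∀ X ∈ S, ∀ Y ∈ S, ‖gradient f X - gradient f Y‖ ≤ β * ‖X - Y‖

/-- `Xs` is an optimal solution of `min f(X)` subject to `X ∈ ℱ_{n,k}`. -/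
def IsOptimal {n : ℕ} (k : ℕ) (f : SymMat n → ℝ) (Xs : SymMat n) : Prop :=
  Xs ∈ fantope n k ∧ IsMinOn f (fantope n k) Xs

/-- The eigengap assumption `λ_{n-k}(∇f(Xs)) - λ_{n-k+1}(∇f(Xs)) ≥ δ` (used for `1 ≤ k < n`). -/
def EigenGap {n : ℕ} (k : ℕ) (f : SymMat n → ℝ) (Xs : SymMat n) (δ : ℝ) : Prop :=
  δ ≤ (gradient f Xs).eig (n - k) - (gradient f Xs).eig (n - k + 1)

/-- `V ∈ argmin_{W ∈ 𝒫_{n,k}} Tr(W G)`. -/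
def IsLinMin {n : ℕ} (k : ℕ) (G V : SymMat n) : Prop :=
  V ∈ projSet n k ∧ ∀ W ∈ projSet n k, (V.toMat * G.toMat).trace ≤ (W.toMat * G.toMat).trace

/-- The step size `η ∈ [0,1]` is chosen by line search from `X` towards `V`: it minimizes over
`[0,1]` either the objective itself along the segment, or the quadratic upper model of the objective
along the segment which comes from `β`-smoothness. -/
def IsLineSearch {n : ℕ} (f : SymMat n → ℝ) (β : ℝ) (X V : SymMat n) (η : ℝ) : Prop :=
  η ∈ Set.Icc (0 : ℝ) 1 ∧
    (IsMinOn (fun s : ℝ => f ((1 - s) • X + s • V)) (Set.Icc 0 1) η ∨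
      IsMinOn (fun s : ℝ => f X + s * inner ℝ (V - X) (gradient f X) + s ^ 2 * β / 2 * ‖V - X‖ ^ 2)
        (Set.Icc 0 1) η)

/-- `(X_t, V_t, η_t)`, `t ≥ 1`, is a run of the Frank-Wolfe method with line search over the
Fantope. -/
structure IsFrankWolfe {n : ℕ} (k : ℕ) (f : SymMat n → ℝ) (β : ℝ)
    (X V : ℕ → SymMat n) (η : ℕ → ℝ) : Prop where
  init : X 1 ∈ fantope n k
  linMin : ∀ t, 1 ≤ t → IsLinMin k (gradient f (X t)) (V t)
  lineSearch : ∀ t, 1 ≤ t → IsLineSearch f β (X t) (V t) (η t)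
  step : ∀ t, 1 ≤ t → X (t + 1) = (1 - η t) • X t + η t • V t

end FantopeFW

end

open Matrix

namespace FantopeFW

variable {n k : ℕ}

/-! ### Spectral decomposition and Weyl's inequality. -/

namespace SymMat

/-! Everything rests on `exists_sharp_minimizer`: an eigengap makes linear minimization over the
Fantope sharp, with growth quadratic in the distance to a spectral projection. At `∇f(X*)` this
projection must be `X*`, which gives quadratic growth of `f`. Comparing `V_t` with `X*` under both
gradients gives `‖V_t - X*‖ ≤ (2β/δ)‖X_t - X*‖`, and with quadratic growth this is the second claim.

For the first claim, write `h_t = f(X_t) - f(X*)`. Once `h_t ≤ δ³/(18β²)`, Weyl's inequality leaves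
a gap `δ/3` at `∇f(X_t)`. Sharpness there bounds `‖X_t - V_t‖²` by `6/δ` times the Frank-Wolfe gap,
so a step of constant size contracts `h_t` (`contraction_near`). The generic rate `4βk/t` reaches
this regime after `O(k(β/δ)³)` steps. If that bound on the burn-in is below `2`, then `δ ≥ 5β` and a
full step contracts from the start (`contraction_of_large_gap`). -/

theorem toMat_sub (A B : SymMat n) : (A - B).toMat = A.toMat - B.toMat := rfl

/-- Spectral decomposition with the eigenvalues in decreasing order. -/
theorem exists_spectral_decomposition (A : SymMat n) :
    ∃ (U : Matrix (Fin n) (Fin n) ℝ) (l : Fin n → ℝ), Antitone l ∧ Uᵀ * U = 1 ∧ U * Uᵀ = 1 ∧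
      A.toMat = U * diagonal l * Uᵀ ∧ ∀ i : Fin n, l i = A.eig (i + 1) := by
  have hA := A.isHermitian
  let c : Fin n ≃ Fin (Fintype.card (Fin n)) := finCongr (Fintype.card_fin n).symm
  let e : Fin n ≃ Fin n := c.trans (Fintype.equivOfCardEq (Fintype.card_fin _))
  let U₀ : Matrix (Fin n) (Fin n) ℝ := hA.eigenvectorUnitary
  have hs : U₀ᴴ = U₀ᵀ := conjTranspose_eq_transpose_of_trivial _
  have h1 : U₀ᵀ * U₀ = 1 := by
    rw [← hs]; exact Unitary.coe_star_mul_self hA.eigenvectorUnitary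
  have h3 : A.toMat = U₀ * diagonal hA.eigenvalues * U₀ᵀ := by
    have h := hA.spectral_theorem
    rw [Unitary.conjStarAlgAut_apply] at h
    rw [← hs]
    exact h
  have hU : (U₀.submatrix id e)ᵀ * U₀.submatrix id e = 1 := by
    have h : (U₀.submatrix id e)ᵀ * U₀.submatrix id e = (U₀ᵀ * U₀).submatrix e e := rfl
    rw [h, h1, submatrix_one_equiv]
  refine ⟨U₀.submatrix id e, fun i => hA.eigenvalues (e i), ?_, hU, mul_eq_one_comm.1 hU, ?_, ?_⟩
  · intro i j hij
    simp only [IsHermitian.eigenvalues, e, Equiv.trans_apply, Equiv.symm_apply_apply]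
    exact hA.eigenvalues₀_antitone hij
  · have hd : diagonal (fun i => hA.eigenvalues (e i)) = (diagonal hA.eigenvalues).submatrix e e :=
      (submatrix_diagonal_equiv hA.eigenvalues e).symm
    rw [hd, transpose_submatrix, submatrix_mul_equiv, submatrix_mul_equiv, submatrix_id_id]
    exact h3
  · intro i
    have h : 1 ≤ (i : ℕ) + 1 ∧ (i : ℕ) + 1 ≤ n := ⟨by omega, i.2⟩
    simp only [eig, dif_pos h, IsHermitian.eigenvalues, e, Equiv.trans_apply,
      Equiv.symm_apply_apply]
    rfl

/-- The rank-one symmetric matrix `x xᵀ`. -/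
def outer (x : Fin n → ℝ) : SymMat n := ⟨vecMulVec x x, transpose_vecMulVec x x⟩

theorem inner_outer (A : SymMat n) (x : Fin n → ℝ) : inner ℝ A (outer x) = x ⬝ᵥ A.toMat *ᵥ x := by
  rw [inner_eq_trace]
  change (A.toMat * vecMulVec x x).trace = _
  rw [mul_vecMulVec, trace_vecMulVec, dotProduct_comm]

theorem norm_outer (x : Fin n → ℝ) : ‖outer x‖ = x ⬝ᵥ x := by
  have h : ‖outer x‖ ^ 2 = (x ⬝ᵥ x) ^ 2 := by
    rw [← real_inner_self_eq_norm_sq, inner_outer]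
    change x ⬝ᵥ vecMulVec x x *ᵥ x = _
    rw [vecMulVec_mulVec]
    simp [sq]
  have h0 : 0 ≤ x ⬝ᵥ x := by simpa using dotProduct_star_self_nonneg x
  exact (sq_eq_sq₀ (norm_nonneg _) h0).1 h

theorem dotProduct_mulVec_le (A : SymMat n) (x : Fin n → ℝ) :
    x ⬝ᵥ A.toMat *ᵥ x ≤ ‖A‖ * (x ⬝ᵥ x) := by
  rw [← inner_outer, ← norm_outer]
  exact real_inner_le_norm _ _

theorem dotProduct_mulVec_diagonalized (U : Matrix (Fin n) (Fin n) ℝ) (l x : Fin n → ℝ) :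
    x ⬝ᵥ (U * diagonal l * Uᵀ) *ᵥ x = ∑ i, l i * (Uᵀ *ᵥ x) i ^ 2 := by
  rw [← mulVec_mulVec, ← mulVec_mulVec, dotProduct_mulVec, ← mulVec_transpose]
  simp only [dotProduct, mulVec_diagonal]
  exact Finset.sum_congr rfl fun i _ => by ring

theorem dotProduct_self_eq_sum {U : Matrix (Fin n) (Fin n) ℝ} (hU : U * Uᵀ = 1) (x : Fin n → ℝ) :
    x ⬝ᵥ x = ∑ i, (Uᵀ *ᵥ x) i ^ 2 := by
  have h := dotProduct_mulVec_diagonalized U (fun _ => 1) x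
  simpa [hU] using h

/-- One half of **Weyl's inequality**. -/
theorem eig_le_eig_add (A B : SymMat n) {i : ℕ} (h1 : 1 ≤ i) (hn : i ≤ n) :
    A.eig i ≤ B.eig i + ‖A - B‖ := by
  obtain ⟨U, l, hl, -, hU, hA, hlA⟩ := A.exists_spectral_decomposition
  obtain ⟨U', l', hl', -, hU', hB, hlB⟩ := B.exists_spectral_decomposition
  let m : Fin n := ⟨i - 1, by omega⟩
  have hm : (m : ℕ) + 1 = i := by simp only [m]; omega
  -- These are `n - 1` linear conditions, so some `x ≠ 0` is orthogonal to the top `i - 1`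
  -- eigenvectors of `B` and to the bottom `n - i` of `A`. Its Rayleigh quotient is at least
  -- `λ_i(A)` for `A` and at most `λ_i(B)` for `B`.
  let L : (Fin n → ℝ) →ₗ[ℝ] ({j : Fin n // j ≠ m} → ℝ) := LinearMap.pi fun j =>
    LinearMap.proj (j : Fin n) ∘ₗ (if (j : Fin n) < m then U'ᵀ.mulVecLin else Uᵀ.mulVecLin)
  have hker : LinearMap.ker L ≠ ⊥ := by
    apply LinearMap.ker_ne_bot_of_finrank_lt
    have : 0 < n := by omega
    simp only [Module.finrank_fintype_fun_eq_card, ne_eq, Fintype.card_subtype_compl,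
      Fintype.card_fin, Fintype.card_unique]
    omega
  obtain ⟨x, hx, hx0⟩ := (Submodule.ne_bot_iff _).1 hker
  have hLx : ∀ j : Fin n, (hj : j ≠ m) → L x ⟨j, hj⟩ = 0 := fun j hj =>
    congrFun (LinearMap.mem_ker.1 hx) ⟨j, hj⟩
  have hlow : ∀ j, j < m → (U'ᵀ *ᵥ x) j = 0 := fun j hj => by
    simpa [L, hj, mulVec_transpose] using hLx j hj.ne
  have hhigh : ∀ j, m < j → (Uᵀ *ᵥ x) j = 0 := fun j hj => by
    simpa [L, hj.le.not_gt, mulVec_transpose] using hLx j hj.ne'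
  have e1 : A.eig i * (x ⬝ᵥ x) ≤ x ⬝ᵥ A.toMat *ᵥ x := by
    rw [hA, dotProduct_mulVec_diagonalized, dotProduct_self_eq_sum hU, Finset.mul_sum]
    refine Finset.sum_le_sum fun j _ => ?_
    rcases lt_or_ge m j with h | h
    · simp [hhigh j h]
    · have := hl h
      rw [hlA m, hm] at this
      gcongr
  have e2 : x ⬝ᵥ B.toMat *ᵥ x ≤ B.eig i * (x ⬝ᵥ x) := by
    rw [hB, dotProduct_mulVec_diagonalized, dotProduct_self_eq_sum hU', Finset.mul_sum]
    refine Finset.sum_le_sum fun j _ => ?_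
    rcases lt_or_ge j m with h | h
    · simp [hlow j h]
    · have := hl' h
      rw [hlB m, hm] at this
      gcongr
  have e3 := dotProduct_mulVec_le (A - B) x
  rw [toMat_sub, sub_mulVec, dotProduct_sub] at e3
  have hpos : 0 < x ⬝ᵥ x := by simpa using dotProduct_star_self_pos_iff.2 hx0
  exact le_of_mul_le_mul_right (by linarith) hpos

end SymMat

open SymMat

/-! ### Projections and the Fantope. -/

theorem inner_mem_nonneg {V W : SymMat n} (hV : V ∈ projSet n k) (hW : W ∈ projSet n k) :
    0 ≤ inner ℝ V W := by
  obtain ⟨Q, -, hQ⟩ := hV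
  obtain ⟨R, -, hR⟩ := hW
  have h : (V.toMat * W.toMat).trace = ((Qᵀ * R)ᵀ * (Qᵀ * R)).trace := by
    rw [hQ, hR, transpose_mul, transpose_transpose, Matrix.mul_assoc Rᵀ, trace_mul_comm Rᵀ]
    simp only [Matrix.mul_assoc]
  rw [inner_eq_trace, h]
  simp only [Matrix.trace, Matrix.diag, Matrix.mul_apply (M := (Qᵀ * R)ᵀ), transpose_apply (Qᵀ * R)]
  exact Finset.sum_nonneg fun i _ => Finset.sum_nonneg fun j _ => mul_self_nonneg _

theorem trace_of_mem_projSet {V : SymMat n} (hV : V ∈ projSet n k) : V.toMat.trace = k := by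
  obtain ⟨Q, hQ, hV⟩ := hV
  rw [hV, trace_mul_comm, hQ, trace_one, Fintype.card_fin]

theorem mul_self_of_mem_projSet {V : SymMat n} (hV : V ∈ projSet n k) :
    V.toMat * V.toMat = V.toMat := by
  obtain ⟨Q, hQ, hV⟩ := hV
  rw [hV, Matrix.mul_assoc, ← Matrix.mul_assoc Qᵀ, hQ, Matrix.one_mul]

theorem norm_sq_of_mem_projSet {V : SymMat n} (hV : V ∈ projSet n k) : ‖V‖ ^ 2 = k := by
  rw [← real_inner_self_eq_norm_sq, inner_eq_trace, mul_self_of_mem_projSet hV,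
    trace_of_mem_projSet hV]

theorem rank_of_mem_projSet {V : SymMat n} (hV : V ∈ projSet n k) : V.toMat.rank = k := by
  obtain ⟨Q, hQ, hV⟩ := hV
  have h : (Qᵀ * Q).rank = k := by rw [hQ, rank_one, Fintype.card_fin]
  rw [hV, rank_self_mul_transpose, ← rank_transpose_mul_self, h]

theorem projSet_subset_fantope : projSet n k ⊆ fantope n k := subset_convexHull ℝ _

theorem convex_fantope : Convex ℝ (fantope n k) := convex_convexHull ℝ _

/-- A linear inequality that is valid on `projSet` is valid on the Fantope. -/
theorem inner_le_of_mem_fantope {G W : SymMat n} {c : ℝ}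
    (h : ∀ V ∈ projSet n k, inner ℝ G V ≤ c) (hW : W ∈ fantope n k) : inner ℝ G W ≤ c :=
  convexHull_min h (convex_halfSpace_le (innerₛₗ ℝ G).isLinear c) hW

theorem le_inner_of_mem_fantope {G W : SymMat n} {c : ℝ}
    (h : ∀ V ∈ projSet n k, c ≤ inner ℝ G V) (hW : W ∈ fantope n k) : c ≤ inner ℝ G W :=
  convexHull_min h (convex_halfSpace_ge (innerₛₗ ℝ G).isLinear c) hW

theorem norm_sq_le_of_mem_fantope {W : SymMat n} (hW : W ∈ fantope n k) : ‖W‖ ^ 2 ≤ k := by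
  have hsub : projSet n k ⊆ Metric.closedBall 0 √k := fun V hV => by
    rw [mem_closedBall_zero_iff]
    exact Real.le_sqrt_of_sq_le (norm_sq_of_mem_projSet hV).le
  have h := convexHull_min hsub (convex_closedBall 0 √k) hW
  rw [mem_closedBall_zero_iff] at h
  exact (Real.le_sqrt (norm_nonneg _) (Nat.cast_nonneg k)).1 h

/-- Expand the square, with `‖V‖² = k` and `‖W‖² ≤ k`. -/
theorem norm_sub_sq_le_of_mem_projSet {V W : SymMat n} (hV : V ∈ projSet n k)
    (hW : W ∈ fantope n k) : ‖W - V‖ ^ 2 ≤ 2 * (k - inner ℝ V W) := by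
  rw [norm_sub_sq_real, norm_sq_of_mem_projSet hV, real_inner_comm]
  linarith [norm_sq_le_of_mem_fantope hW]

theorem norm_sub_sq_le {V W : SymMat n} (hV : V ∈ projSet n k)
    (hW : W ∈ fantope n k) : ‖W - V‖ ^ 2 ≤ 2 * k := by
  linarith [norm_sub_sq_le_of_mem_projSet hV hW,
    le_inner_of_mem_fantope (fun V' hV' => inner_mem_nonneg hV hV') hW]

theorem dotProduct_mulVec_nonneg_of_mem_fantope {W : SymMat n} (hW : W ∈ fantope n k)
    (x : Fin n → ℝ) : 0 ≤ x ⬝ᵥ W.toMat *ᵥ x := by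
  rw [← inner_outer, real_inner_comm]
  refine le_inner_of_mem_fantope (fun V hV => ?_) hW
  rw [real_inner_comm, inner_outer, ← mul_self_of_mem_projSet hV, ← mulVec_mulVec,
    dotProduct_mulVec, ← mulVec_transpose, V.transpose_toMat]
  simpa using dotProduct_star_self_nonneg (V.toMat *ᵥ x)

theorem dotProduct_mulVec_le_of_mem_fantope {W : SymMat n} (hW : W ∈ fantope n k)
    (x : Fin n → ℝ) : x ⬝ᵥ W.toMat *ᵥ x ≤ x ⬝ᵥ x := by
  rw [← inner_outer, real_inner_comm]
  refine inner_le_of_mem_fantope (fun V hV => ?_) hW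
  rw [real_inner_comm, inner_outer]
  have h1 : x ⬝ᵥ V.toMat *ᵥ x = (V.toMat *ᵥ x) ⬝ᵥ (V.toMat *ᵥ x) := by
    conv_lhs => rw [← mul_self_of_mem_projSet hV]
    rw [← mulVec_mulVec, dotProduct_mulVec, ← mulVec_transpose, V.transpose_toMat]
  have h2 : 0 ≤ (x - V.toMat *ᵥ x) ⬝ᵥ (x - V.toMat *ᵥ x) := by
    simpa using dotProduct_star_self_nonneg (x - V.toMat *ᵥ x)
  simp only [sub_dotProduct, dotProduct_sub, dotProduct_comm (V.toMat *ᵥ x) x] at h2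
  linarith

theorem trace_of_mem_fantope {W : SymMat n} (hW : W ∈ fantope n k) : W.toMat.trace = k := by
  let I : SymMat n := ⟨1, transpose_one⟩
  have hI : ∀ V : SymMat n, inner ℝ I V = V.toMat.trace := fun V => by
    rw [inner_eq_trace]
    change (1 * V.toMat).trace = _
    rw [Matrix.one_mul]
  rw [← hI]
  exact le_antisymm
    (inner_le_of_mem_fantope (fun V hV => by rw [hI, trace_of_mem_projSet hV]) hW)
    (le_inner_of_mem_fantope (fun V hV => by rw [hI, trace_of_mem_projSet hV]) hW)

/-! ### Linear minimization under an eigengap. -/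

theorem trace_mul_diagonalized (W U : Matrix (Fin n) (Fin n) ℝ) (l : Fin n → ℝ) :
    (W * (U * diagonal l * Uᵀ)).trace = ∑ i, l i * (Uᵀ i ⬝ᵥ W *ᵥ Uᵀ i) := by
  have h : (W * (U * diagonal l * Uᵀ)).trace = (diagonal l * (Uᵀ * W * U)).trace := by
    rw [← Matrix.mul_assoc, trace_mul_comm, ← Matrix.mul_assoc, ← Matrix.mul_assoc,
      trace_mul_comm, Matrix.mul_assoc]
  rw [h, Matrix.trace]
  refine Finset.sum_congr rfl fun i _ => ?_
  rw [diag_apply, diagonal_mul, Matrix.mul_assoc, mul_apply_eq_vecMul]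
  rfl

/-- If `G` has an eigengap, the spectral projection onto its `k` smallest eigenvalues is a sharp
minimizer of `⟨·, G⟩` over the Fantope. -/
theorem exists_sharp_minimizer (h1 : 1 ≤ k) (hn : k < n) {G : SymMat n} {d : ℝ}
    (hd : 0 ≤ d) (hG : d ≤ G.eig (n - k) - G.eig (n - k + 1)) :
    ∃ P ∈ projSet n k, ∀ W ∈ fantope n k, d / 2 * ‖W - P‖ ^ 2 ≤ inner ℝ (W - P) G := by
  obtain ⟨U, l, hl, hU, hU', hGU, hlG⟩ := G.exists_spectral_decomposition
  -- Indices start at zero: `a` and `b` carry `λ_{n-k}` and `λ_{n-k+1}`, the two sides of the gap.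
  let a : Fin n := ⟨n - k - 1, by omega⟩
  let b : Fin n := ⟨n - k, by omega⟩
  have ha : l a = G.eig (n - k) := by rw [hlG]; congr 1; simp only [a]; omega
  have hb : l b = G.eig (n - k + 1) := by rw [hlG]
  let g : Fin k → Fin n := fun j => ⟨n - k + j, by omega⟩
  have hg : Function.Injective g := fun i j hij => by
    have := congrArg Fin.val hij
    simp only [g] at this
    exact Fin.ext (by omega)
  let Q : Matrix (Fin n) (Fin k) ℝ := U.submatrix id g
  have hQ : Qᵀ * Q = 1 := by
    have : Qᵀ * Q = (Uᵀ * U).submatrix g g := rfl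
    rw [this, hU, submatrix_one _ hg]
  let e : Fin n → ℝ := fun i => if b ≤ i then 1 else 0
  have hQe : Q * Qᵀ = U * diagonal e * Uᵀ := by
    ext i j
    rw [mul_apply, mul_apply]
    simp only [mul_diagonal, transpose_apply, e, mul_ite, mul_one, mul_zero, ite_mul, zero_mul]
    rw [← Finset.sum_filter]
    refine Finset.sum_bij (fun x _ => g x) (fun x _ => ?_) (fun x _ y _ h => hg h) (fun y hy => ?_)
      (fun x _ => rfl)
    · rw [Finset.mem_filter]
      exact ⟨Finset.mem_univ _, Fin.le_def.2 (Nat.le_add_right _ _)⟩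
    · have hy' : n - k ≤ (y : ℕ) := by simpa [b, Fin.le_def] using hy
      exact ⟨⟨y - (n - k), by omega⟩, Finset.mem_univ _, Fin.ext (by simp only [g]; omega)⟩
  let P : SymMat n := ⟨Q * Qᵀ, by
    change (Q * Qᵀ)ᵀ = Q * Qᵀ
    rw [transpose_mul, transpose_transpose]⟩
  have hP : P ∈ projSet n k := ⟨Q, hQ, rfl⟩
  have hPm : P.toMat = U * diagonal e * Uᵀ := hQe
  have hcol : ∀ i, Uᵀ i ⬝ᵥ Uᵀ i = 1 := fun i => by
    have := congrFun (congrFun hU i) i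
    rwa [mul_apply, one_apply_eq] at this
  refine ⟨P, hP, fun W hW => ?_⟩
  let p : Fin n → ℝ := fun i => Uᵀ i ⬝ᵥ W.toMat *ᵥ Uᵀ i
  have hp0 : ∀ i, 0 ≤ p i := fun i => dotProduct_mulVec_nonneg_of_mem_fantope hW _
  have hp1 : ∀ i, p i ≤ 1 := fun i =>
    (dotProduct_mulVec_le_of_mem_fantope hW _).trans (hcol i).le
  have hpk : ∑ i, p i = k := by
    have := trace_mul_diagonalized W.toMat U (fun _ => 1)
    simp only [diagonal_one, Matrix.mul_one, hU', trace_of_mem_fantope hW, one_mul] at this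
    exact this.symm
  have hcard : ∑ i, e i = k := by
    have := trace_diagonal e
    rw [← this, ← trace_of_mem_projSet hP, hPm, trace_mul_comm, ← Matrix.mul_assoc, hU,
      Matrix.one_mul]
  have hWP : inner ℝ P W = ∑ i, e i * p i := by
    rw [real_inner_comm, inner_eq_trace, hPm, trace_mul_diagonalized]
  have hWG : inner ℝ W G = ∑ i, l i * p i := by
    rw [inner_eq_trace, hGU, trace_mul_diagonalized]
  have hPG : inner ℝ P G = ∑ i, l i * e i := by
    rw [inner_eq_trace, hGU, hPm]
    have : U * diagonal e * Uᵀ * (U * diagonal l * Uᵀ) = U * diagonal (fun i => l i * e i) * Uᵀ := by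
      calc _ = U * diagonal e * (Uᵀ * U) * diagonal l * Uᵀ := by simp only [Matrix.mul_assoc]
        _ = _ := by
          rw [hU, Matrix.mul_one, Matrix.mul_assoc U, diagonal_mul_diagonal]
          simp only [mul_comm]
    rw [this, trace_mul_comm, ← Matrix.mul_assoc, hU, Matrix.one_mul, trace_diagonal]
  -- In the eigenbasis `W` has diagonal `p` and `P` has diagonal `e`, both of sum `k`. On summation
  -- the `l b` term cancels, and what remains is the gap times `k - ⟨P, W⟩`, the mass of `W` outside
  -- the range of `P`, which is at least `‖W - P‖² / 2`.
  have key : ∀ i, l b * (p i - e i) + (l a - l b) * ((1 - e i) * p i) ≤ l i * (p i - e i) := by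
    intro i
    by_cases hi : b ≤ i
    · have : l i ≤ l b := hl hi
      simp only [e, if_pos hi]
      nlinarith [hp1 i]
    · have : l a ≤ l i := hl (by
        rw [Fin.le_def] at hi ⊢
        simp only [a, b] at hi ⊢
        omega)
      simp only [e, if_neg hi]
      nlinarith [hp0 i]
  have hsum := Finset.sum_le_sum fun i (_ : i ∈ Finset.univ) => key i
  have hlow : (l a - l b) * (k - inner ℝ P W) ≤ inner ℝ (W - P) G := by
    rw [inner_sub_left, hWG, hPG, hWP]
    simp only [Finset.sum_add_distrib, ← Finset.mul_sum, mul_sub, sub_mul, one_mul,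
      Finset.sum_sub_distrib, hpk, hcard] at hsum
    linarith
  have hdist := norm_sub_sq_le_of_mem_projSet hP hW
  rw [← ha, ← hb] at hG
  nlinarith [sq_nonneg ‖W - P‖]

/-! ### First-order inequalities along segments. -/

section Gradient

variable {f : SymMat n → ℝ} {S : Set (SymMat n)} {β : ℝ} {X Y : SymMat n}

theorem hasDerivAt_comp_line {s : ℝ} (hf : DifferentiableAt ℝ f (X + s • Y)) :
    HasDerivAt (fun s : ℝ => f (X + s • Y)) (inner ℝ (gradient f (X + s • Y)) Y) s := by
  have h1 : HasDerivAt (fun s : ℝ => X + s • Y) Y s := by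
    simpa using ((hasDerivAt_id s).smul_const Y).const_add X
  have h2 := hf.hasGradientAt.hasFDerivAt.comp_hasDerivAt s h1
  simpa using! h2

theorem line_mem (hS : Convex ℝ S) (hX : X ∈ S) (hY : Y ∈ S) {s : ℝ} (hs : s ∈ Set.Icc (0 : ℝ) 1) :
    X + s • (Y - X) ∈ S :=
  hS.add_smul_sub_mem hX hY hs

theorem ConvexSmoothOn.gradient_inequality (hf : ConvexSmoothOn f S β) (hX : X ∈ S) (hY : Y ∈ S) :
    f X + inner ℝ (Y - X) (gradient f X) ≤ f Y := by
  have hc : ConvexOn ℝ (Set.Icc (0 : ℝ) 1) (fun s : ℝ => f (X + s • (Y - X))) := by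
    refine ⟨convex_Icc 0 1, fun s hs t ht a b ha hb hab => ?_⟩
    have h := hf.convexOn.2 (line_mem hf.convexOn.1 hX hY hs) (line_mem hf.convexOn.1 hX hY ht)
      ha hb hab
    have e : X + (a • s + b • t) • (Y - X) = a • (X + s • (Y - X)) + b • (X + t • (Y - X)) := by
      obtain rfl : b = 1 - a := by linarith
      simp only [smul_eq_mul]
      module
    simp only [e]
    exact h
  have hd := hasDerivAt_comp_line (f := f) (X := X) (Y := Y - X) (s := 0)
    (by simpa using hf.differentiableAt X hX)
  have h := hc.le_slope_of_hasDerivAt (Set.left_mem_Icc.2 zero_le_one)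
    (Set.right_mem_Icc.2 zero_le_one) one_pos hd
  simp only [slope_def_field, zero_smul, add_zero, one_smul, add_sub_cancel, sub_zero,
    div_one] at h
  rw [real_inner_comm]
  linarith

theorem ConvexSmoothOn.descent (hf : ConvexSmoothOn f S β) (hX : X ∈ S) (hY : Y ∈ S) {s : ℝ}
    (hs : s ∈ Set.Icc (0 : ℝ) 1) :
    f (X + s • (Y - X)) ≤
      f X + s * inner ℝ (Y - X) (gradient f X) + s ^ 2 * β / 2 * ‖Y - X‖ ^ 2 := by
  -- The Lipschitz bound on the gradient makes the derivative of objective minus model nonpositive,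
  -- and the two agree at `0`.
  let φ : ℝ → ℝ := fun s => f (X + s • (Y - X)) -
    (s * inner ℝ (Y - X) (gradient f X) + s ^ 2 * (β / 2 * ‖Y - X‖ ^ 2))
  have hφ : ∀ r ∈ Set.Icc (0 : ℝ) 1, HasDerivAt φ
      (inner ℝ (gradient f (X + r • (Y - X))) (Y - X) -
        (inner ℝ (Y - X) (gradient f X) + r * (β * ‖Y - X‖ ^ 2))) r := by
    intro r hr
    have h1 := hasDerivAt_comp_line (hf.differentiableAt _ (line_mem hf.convexOn.1 hX hY hr))
    have h2 := ((hasDerivAt_id r).mul_const (inner ℝ (Y - X) (gradient f X))).add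
      ((hasDerivAt_pow 2 r).mul_const (β / 2 * ‖Y - X‖ ^ 2))
    convert! h1.sub h2 using 1
    norm_num
    ring
  have hanti : AntitoneOn φ (Set.Icc 0 1) := by
    refine antitoneOn_of_deriv_nonpos (convex_Icc 0 1)
      (fun r hr => (hφ r hr).continuousAt.continuousWithinAt)
      (fun r hr => (hφ r (interior_subset hr)).differentiableAt.differentiableWithinAt)
      fun r hr => ?_
    have hr := interior_subset hr
    rw [(hφ r hr).deriv, real_inner_comm (gradient f X), ← sub_sub, ← inner_sub_left]
    have h1 := real_inner_le_norm (gradient f (X + r • (Y - X)) - gradient f X) (Y - X)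
    have h2 := hf.lipschitz _ (line_mem hf.convexOn.1 hX hY hr) X hX
    rw [add_sub_cancel_left, norm_smul, Real.norm_of_nonneg hr.1] at h2
    nlinarith [norm_nonneg (Y - X)]
  have h := hanti (Set.left_mem_Icc.2 zero_le_one) hs hs.1
  simp only [φ, zero_smul, add_zero, zero_mul, sub_zero, ne_eq, OfNat.ofNat_ne_zero,
    not_false_eq_true, zero_pow] at h
  linarith

end Gradient

/-! ### Consequences of the eigengap at the optimum. -/

section Optimum

variable {f : SymMat n → ℝ} {β δ : ℝ} {Xs X V : SymMat n}

theorem IsOptimal.inner_gradient_nonneg (hf : ConvexSmoothOn f (fantope n k) β)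
    (hXs : IsOptimal k f Xs) {W : SymMat n} (hW : W ∈ fantope n k) :
    0 ≤ inner ℝ (W - Xs) (gradient f Xs) := by
  have h := (hXs.2.localize).hasFDerivWithinAt_nonneg
    ((hf.differentiableAt Xs hXs.1).hasGradientAt.hasFDerivAt.hasFDerivWithinAt)
    (sub_mem_posTangentConeAt_of_segment_subset (convex_fantope.segment_subset hXs.1 hW))
  rw [real_inner_comm]
  simpa using! h

/-- First-order optimality makes `X*` a linear minimizer for its own gradient, and sharpness leaves
only one such minimizer, `P`. -/
theorem IsOptimal.sharp (h1 : 1 ≤ k) (hn : k < n) (hf : ConvexSmoothOn f (fantope n k) β)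
    (hδ : 0 < δ) (hXs : IsOptimal k f Xs) (hgap : EigenGap k f Xs δ) {W : SymMat n}
    (hW : W ∈ fantope n k) : δ / 2 * ‖W - Xs‖ ^ 2 ≤ inner ℝ (W - Xs) (gradient f Xs) := by
  obtain ⟨P, hP, hsharp⟩ := exists_sharp_minimizer h1 hn hδ.le hgap
  have ha := hsharp Xs hXs.1
  have hb := hXs.inner_gradient_nonneg hf (projSet_subset_fantope hP)
  rw [← neg_sub, inner_neg_left] at hb
  have h0 : ‖Xs - P‖ ^ 2 ≤ 0 := by nlinarith [sq_nonneg ‖Xs - P‖]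
  have : Xs = P := by
    rw [← sub_eq_zero, ← norm_eq_zero]
    exact pow_eq_zero_iff two_ne_zero |>.1 (le_antisymm h0 (sq_nonneg _))
  rw [this] at hsharp ⊢
  exact hsharp W hW

theorem IsOptimal.quadratic_growth (h1 : 1 ≤ k) (hn : k < n)
    (hf : ConvexSmoothOn f (fantope n k) β) (hδ : 0 < δ) (hXs : IsOptimal k f Xs)
    (hgap : EigenGap k f Xs δ) (hX : X ∈ fantope n k) :
    δ / 2 * ‖X - Xs‖ ^ 2 ≤ f X - f Xs := by
  linarith [hXs.sharp h1 hn hf hδ hgap hX, hf.gradient_inequality hXs.1 hX]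

theorem IsLinMin.inner_le {G W : SymMat n} (hV : IsLinMin k G V) (hW : W ∈ fantope n k) :
    inner ℝ V G ≤ inner ℝ W G := by
  rw [real_inner_comm G W]
  refine le_inner_of_mem_fantope (fun W' hW' => ?_) hW
  rw [real_inner_comm W' G]
  exact hV.2 W' hW'

theorem IsLinMin.inner_sub_le (hf : ConvexSmoothOn f (fantope n k) β) (hXs : IsOptimal k f Xs)
    (hX : X ∈ fantope n k) (hV : IsLinMin k (gradient f X) V) :
    inner ℝ (V - X) (gradient f X) ≤ -(f X - f Xs) := by
  have ha := hf.gradient_inequality hX hXs.1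
  have hb := hV.inner_le hXs.1
  rw [inner_sub_left] at ha ⊢
  linarith

/-- Sharpness at `X*` bounds `⟨V - X*, ∇f(X*)⟩` from below, and `⟨V - X*, ∇f(X)⟩ ≤ 0`.
Cauchy–Schwarz bounds the difference of the two pairings by `β‖X - X*‖‖V - X*‖`. -/
theorem IsLinMin.norm_sub_le (h1 : 1 ≤ k) (hn : k < n) (hf : ConvexSmoothOn f (fantope n k) β)
    (hδ : 0 < δ) (hXs : IsOptimal k f Xs) (hgap : EigenGap k f Xs δ) (hX : X ∈ fantope n k)
    (hV : IsLinMin k (gradient f X) V) : δ / 2 * ‖V - Xs‖ ≤ β * ‖X - Xs‖ := by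
  have ha := hXs.sharp h1 hn hf hδ hgap (projSet_subset_fantope hV.1)
  have hb : inner ℝ (V - Xs) (gradient f X) ≤ 0 := by
    rw [inner_sub_left]
    linarith [hV.inner_le hXs.1]
  have hc := real_inner_le_norm (V - Xs) (gradient f Xs - gradient f X)
  have hd := hf.lipschitz Xs hXs.1 X hX
  rw [inner_sub_right] at hc
  rw [norm_sub_rev Xs X] at hd
  rcases (norm_nonneg (V - Xs)).eq_or_lt with h0 | h0
  · rw [← h0, mul_zero]
    exact (norm_nonneg _).trans hd
  · refine le_of_mul_le_mul_left ?_ h0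
    nlinarith

theorem IsLinMin.norm_sub_sq_le (h1 : 1 ≤ k) (hn : k < n)
    (hf : ConvexSmoothOn f (fantope n k) β) (hδ : 0 < δ) (hXs : IsOptimal k f Xs)
    (hgap : EigenGap k f Xs δ) (hX : X ∈ fantope n k) (hV : IsLinMin k (gradient f X) V) :
    ‖V - Xs‖ ^ 2 ≤ 8 * (β ^ 2 / δ ^ 3 * (f X - f Xs)) := by
  have ha := pow_le_pow_left₀ (by positivity) (hV.norm_sub_le h1 hn hf hδ hXs hgap hX) 2
  have hb := hXs.quadratic_growth h1 hn hf hδ hgap hX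
  have hc : 8 * (β ^ 2 / δ ^ 3 * (f X - f Xs)) = 8 * β ^ 2 * (f X - f Xs) / δ ^ 3 := by ring
  rw [hc, le_div_iff₀ (by positivity)]
  have hd := mul_le_mul_of_nonneg_left ha hδ.le
  have he := mul_le_mul_of_nonneg_left hb (sq_nonneg β)
  nlinarith

theorem IsLinMin.sharp_of_gap (h1 : 1 ≤ k) (hn : k < n) {G W : SymMat n} {d : ℝ} (hd : 0 < d)
    (hG : d ≤ G.eig (n - k) - G.eig (n - k + 1)) (hV : IsLinMin k G V) (hW : W ∈ fantope n k) :
    d / 2 * ‖W - V‖ ^ 2 ≤ inner ℝ (W - V) G := by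
  obtain ⟨P, hP, hsharp⟩ := exists_sharp_minimizer h1 hn hd.le hG
  have ha := hsharp V (projSet_subset_fantope hV.1)
  have hb := hV.inner_le (projSet_subset_fantope hP)
  rw [inner_sub_left] at ha
  have h0 : ‖V - P‖ ^ 2 ≤ 0 := by nlinarith [sq_nonneg ‖V - P‖]
  have : V = P := by
    rw [← sub_eq_zero, ← norm_eq_zero]
    exact pow_eq_zero_iff two_ne_zero |>.1 (le_antisymm h0 (sq_nonneg _))
  rw [this]
  exact hsharp W hW

/-- The eigengap at the optimum persists, up to a factor `3`, where the objective is almost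
optimal. -/
theorem IsOptimal.eigengap_near (h1 : 1 ≤ k) (hn : k < n) (hf : ConvexSmoothOn f (fantope n k) β)
    (hδ : 0 < δ) (hXs : IsOptimal k f Xs) (hgap : EigenGap k f Xs δ)
    (hX : X ∈ fantope n k) (hsmall : 18 * β ^ 2 * (f X - f Xs) ≤ δ ^ 3) :
    δ / 3 ≤ (gradient f X).eig (n - k) - (gradient f X).eig (n - k + 1) := by
  have hg := hXs.quadratic_growth h1 hn hf hδ hgap hX
  -- The constant `18` is chosen for this: `‖X - X*‖² ≤ 2h/δ ≤ δ²/(9β²)`, with `h = f(X) - f(X*)`.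
  -- Each of the two eigenvalues then moves by at most `δ/3`.
  have hdist : β * ‖X - Xs‖ ≤ δ / 3 := by
    refine abs_le_of_sq_le_sq' ?_ (by positivity) |>.2
    have := mul_le_mul_of_nonneg_left hg (sq_nonneg β)
    refine le_of_mul_le_mul_left ?_ hδ
    nlinarith
  have hl := hf.lipschitz Xs hXs.1 X hX
  have hw1 := eig_le_eig_add (gradient f Xs) (gradient f X) (i := n - k) (by omega) (by omega)
  have hw2 := eig_le_eig_add (gradient f X) (gradient f Xs) (i := n - k + 1) (by omega) (by omega)
  rw [norm_sub_rev] at hw2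
  rw [norm_sub_rev Xs X] at hl
  have hgap' : δ ≤ _ := hgap
  linarith

end Optimum

/-! ### Progress of the iteration. -/

section Iteration

variable {f : SymMat n → ℝ} {β δ : ℝ} {Xs : SymMat n}

/-- Either rule does at least as well as the quadratic model at any trial step `s`, so later proofs
choose `s` freely. -/
theorem IsLineSearch.le_model {X V : SymMat n} {η : ℝ} (hf : ConvexSmoothOn f (fantope n k) β)
    (hX : X ∈ fantope n k) (hV : V ∈ fantope n k) (hη : IsLineSearch f β X V η) {s : ℝ}
    (hs : s ∈ Set.Icc (0 : ℝ) 1) :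
    f ((1 - η) • X + η • V) ≤
      f X + s * inner ℝ (V - X) (gradient f X) + s ^ 2 * β / 2 * ‖V - X‖ ^ 2 := by
  have e : ∀ r : ℝ, (1 - r) • X + r • V = X + r • (V - X) := fun r => by module
  rcases hη.2 with h | h
  · have h' := h hs
    simp only [Set.mem_ofPred_eq] at h'
    refine h'.trans ?_
    rw [e]
    exact hf.descent hX hV hs
  · rw [e]
    exact (hf.descent hX hV hη.1).trans (h hs)

variable {X V : ℕ → SymMat n} {η : ℕ → ℝ}

theorem IsFrankWolfe.mem_fantope (h : IsFrankWolfe k f β X V η) {t : ℕ} (ht : 1 ≤ t) :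
    X t ∈ fantope n k := by
  induction t, ht using Nat.le_induction with
  | base => exact h.init
  | succ t ht ih =>
    rw [h.step t ht]
    have hη := (h.lineSearch t ht).1
    exact convex_fantope ih (projSet_subset_fantope (h.linMin t ht).1) (by linarith [hη.2]) hη.1
      (by ring)

theorem IsFrankWolfe.step_le (h : IsFrankWolfe k f β X V η)
    (hf : ConvexSmoothOn f (fantope n k) β) {t : ℕ} (ht : 1 ≤ t) {s : ℝ}
    (hs : s ∈ Set.Icc (0 : ℝ) 1) :
    f (X (t + 1)) ≤ f (X t) + s * inner ℝ (V t - X t) (gradient f (X t)) +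
      s ^ 2 * β / 2 * ‖V t - X t‖ ^ 2 := by
  rw [h.step t ht]
  exact (h.lineSearch t ht).le_model hf (h.mem_fantope ht)
    (projSet_subset_fantope (h.linMin t ht).1) hs

/-- The sublinear rate of the Frank-Wolfe method, for the Fantope of squared diameter `2k`. -/
theorem IsFrankWolfe.sublinear_rate (h : IsFrankWolfe k f β X V η)
    (hf : ConvexSmoothOn f (fantope n k) β) (hβ : 0 < β) (hXs : IsOptimal k f Xs) {t : ℕ}
    (ht : 2 ≤ t) : (f (X t) - f Xs) * t ≤ 4 * β * k := by
  have hstep : ∀ t, 1 ≤ t → ∀ s ∈ Set.Icc (0 : ℝ) 1,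
      f (X (t + 1)) - f Xs ≤ (1 - s) * (f (X t) - f Xs) + s ^ 2 * (β * k) := by
    intro t ht s hs
    have ha := h.step_le hf ht hs
    have hb := (h.linMin t ht).inner_sub_le hf hXs (h.mem_fantope ht)
    have hc := norm_sub_sq_le (h.linMin t ht).1 (h.mem_fantope ht)
    rw [norm_sub_rev] at hc
    have hd := mul_le_mul_of_nonneg_left hb hs.1
    have he := mul_le_mul_of_nonneg_left hc (by positivity : 0 ≤ s ^ 2 * β / 2)
    linarith
  have hK : 0 ≤ β * k := by positivity
  induction t, ht using Nat.le_induction with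
  | base =>
    -- The trial step `1` removes `h_1`, which is not bounded in advance.
    have := hstep 1 le_rfl 1 ⟨zero_le_one, le_rfl⟩
    norm_num at this ⊢
    linarith
  | succ t ht ih =>
    have ht' : (2 : ℝ) ≤ t := by exact_mod_cast ht
    have ht0 : (0 : ℝ) < t := by linarith
    -- With `s = 2/t` the induction closes because `(t - 1)(t + 1) ≤ t²`.
    have ha := hstep t (by omega) (2 / t) ⟨by positivity, (div_le_one ht0).2 ht'⟩
    have hb := mul_le_mul_of_nonneg_right ha (by positivity : (0 : ℝ) ≤ t ^ 2)
    have hc : ((1 - 2 / t) * (f (X t) - f Xs) + (2 / t) ^ 2 * (β * k)) * (t : ℝ) ^ 2 =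
        (t - 2) * ((f (X t) - f Xs) * t) + 4 * (β * k) := by
      field_simp
      ring
    rw [hc] at hb
    have hd := mul_le_mul_of_nonneg_left ih (by linarith : (0 : ℝ) ≤ t - 2)
    have he : (f (X (t + 1)) - f Xs) * (t : ℝ) ^ 2 ≤ 4 * (β * k) * (t - 1) := by linarith
    push_cast
    refine le_of_mul_le_mul_right ?_ (by positivity : (0 : ℝ) < t ^ 2)
    have hg := mul_le_mul_of_nonneg_right he (by positivity : (0 : ℝ) ≤ t + 1)
    nlinarith

theorem IsFrankWolfe.contraction_near (h : IsFrankWolfe k f β X V η) (h1 : 1 ≤ k) (hn : k < n)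
    (hf : ConvexSmoothOn f (fantope n k) β) (hβ : 0 < β) (hδ : 0 < δ) (hXs : IsOptimal k f Xs)
    (hgap : EigenGap k f Xs δ) {t : ℕ} (ht : 1 ≤ t)
    (hsmall : 18 * β ^ 2 * (f (X t) - f Xs) ≤ δ ^ 3) :
    f (X (t + 1)) - f Xs ≤ (f (X t) - f Xs) * (1 - min (δ / (12 * β)) (1 / 2)) := by
  have hX := h.mem_fantope ht
  have hV := h.linMin t ht
  have hg := hV.inner_sub_le hf hXs hX
  have hs := hV.sharp_of_gap h1 hn (by positivity : 0 < δ / 3)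
    (hXs.eigengap_near h1 hn hf hδ hgap hX hsmall) hX
  rw [norm_sub_rev, ← neg_sub (V t), inner_neg_left] at hs
  have hm0 : 0 ≤ min (δ / (12 * β)) (1 / 2) := by positivity
  have hm1 : min (δ / (12 * β)) (1 / 2) ≤ 1 / 2 := min_le_right _ _
  have hm2 : min (δ / (12 * β)) (1 / 2) * (12 * β) ≤ δ :=
    (le_div_iff₀ (by positivity)).1 (min_le_left _ _)
  set m := min (δ / (12 * β)) (1 / 2)
  -- At `s = 2m` the linear term gains `2m` times the Frank-Wolfe gap; since `12βm ≤ δ`, sharpness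
  -- lets the quadratic term cost at most half of that.
  have hstep := h.step_le hf ht (s := 2 * m) ⟨by linarith, by linarith⟩
  have hq := norm_nonneg (V t - X t)
  have ha := mul_le_mul_of_nonneg_right hm2 (by positivity : 0 ≤ m * ‖V t - X t‖ ^ 2 / 6)
  have hb := mul_le_mul_of_nonneg_left hs hm0
  have hc := mul_le_mul_of_nonneg_left hg hm0
  nlinarith

/-- A full step cancels `h_t` to first order. Since `V_t` is close to `X*`, quadratic growth bounds
the remaining `(β/2)‖V_t - X_t‖²` by `h_t/2`. -/
theorem IsFrankWolfe.contraction_of_large_gap (h : IsFrankWolfe k f β X V η) (h1 : 1 ≤ k)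
    (hn : k < n) (hf : ConvexSmoothOn f (fantope n k) β) (hβ : 0 < β) (hδ : 5 * β ≤ δ)
    (hXs : IsOptimal k f Xs) (hgap : EigenGap k f Xs δ) {t : ℕ} (ht : 1 ≤ t) :
    f (X (t + 1)) - f Xs ≤ (f (X t) - f Xs) * (1 - min (δ / (12 * β)) (1 / 2)) := by
  have hδ0 : 0 < δ := by linarith
  have hX := h.mem_fantope ht
  have hV := h.linMin t ht
  have hg := hV.inner_sub_le hf hXs hX
  have hgrowth := hXs.quadratic_growth h1 hn hf hδ0 hgap hX
  have hclose : ‖V t - Xs‖ ≤ 2 / 5 * ‖X t - Xs‖ := by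
    have := hV.norm_sub_le h1 hn hf hδ0 hXs hgap hX
    have ha := mul_le_mul_of_nonneg_right hδ (norm_nonneg (V t - Xs))
    refine le_of_mul_le_mul_left ?_ hβ
    linarith
  have htri : ‖V t - X t‖ ≤ 7 / 5 * ‖X t - Xs‖ := by
    have := norm_sub_le_norm_sub_add_norm_sub (V t) Xs (X t)
    rw [norm_sub_rev Xs] at this
    linarith
  have hsq := pow_le_pow_left₀ (norm_nonneg _) htri 2
  have hstep := h.step_le hf ht (s := 1) ⟨zero_le_one, le_rfl⟩
  have hh : 0 ≤ f (X t) - f Xs := sub_nonneg.2 (hXs.2 hX)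
  have hb : β / 2 * ‖V t - X t‖ ^ 2 ≤ 1 / 2 * (f (X t) - f Xs) := by
    have ha := mul_le_mul_of_nonneg_left hsq hβ.le
    have hc := mul_le_mul_of_nonneg_right hδ (sq_nonneg ‖X t - Xs‖)
    nlinarith
  have hm := mul_le_mul_of_nonneg_left (min_le_right (δ / (12 * β)) (1 / 2)) hh
  linarith

end Iteration

end FantopeFW

theorem theorem5 :
    ∃ C : ℝ, 0 < C ∧
      ∀ (n k : ℕ), 1 ≤ k → k < n →
      ∀ (f : FantopeFW.SymMat n → ℝ) (β δ : ℝ), 0 < β → 0 < δ →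
      FantopeFW.ConvexSmoothOn f (FantopeFW.fantope n k) β →
      ∀ (Xs : FantopeFW.SymMat n), FantopeFW.IsOptimal k f Xs → FantopeFW.EigenGap k f Xs δ →
      ∀ (X V : ℕ → FantopeFW.SymMat n) (η : ℕ → ℝ), FantopeFW.IsFrankWolfe k f β X V η →
        (∃ T₀ : ℕ, (T₀ : ℝ) ≤ C * (k * (β / δ) ^ 3) ∧
          ∀ t : ℕ, 1 ≤ t → T₀ ≤ t →
            f (X (t + 1)) - f Xs ≤ (f (X t) - f Xs) * (1 - min (δ / (12 * β)) (1 / 2))) ∧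
        (∀ t : ℕ, 1 ≤ t →
          (V t).toMat.rank = k ∧
          ‖V t - Xs‖ ^ 2 ≤ C * (β ^ 2 / δ ^ 3 * (f (X t) - f Xs))) := by
  -- As `2/250 = (1/5)³`, a burn-in bound below `2` forces `β/δ ≤ 1/5`. Otherwise the floor is at
  -- least `2`, as the sublinear rate requires, and `250` exceeds the needed `72 = 18 · 4` by enough
  -- to absorb the rounding.
  refine ⟨250, by norm_num, fun n k h1 hn f β δ hβ hδ hf Xs hXs hgap X V η h => ⟨?_, ?_⟩⟩
  · rcases lt_or_ge (250 * (k * (β / δ) ^ 3)) 2 with hT | hT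
    · refine ⟨0, by rw [Nat.cast_zero]; positivity, fun t ht _ => ?_⟩
      refine h.contraction_of_large_gap h1 hn hf hβ ?_ hXs hgap ht
      have hk : (1 : ℝ) ≤ k := by exact_mod_cast h1
      have hx : (β / δ) ^ 3 ≤ (1 / 5) ^ 3 := by
        have := mul_le_mul_of_nonneg_right hk (by positivity : 0 ≤ (β / δ) ^ 3)
        linarith
      have hx' := le_of_pow_le_pow_left₀ three_ne_zero (by norm_num) hx
      rw [div_le_iff₀ hδ] at hx'
      linarith
    · refine ⟨⌊250 * (k * (β / δ) ^ 3)⌋₊, Nat.floor_le (by positivity), fun t ht hTt => ?_⟩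
      refine h.contraction_near h1 hn hf hβ hδ hXs hgap ht ?_
      have h2 : 2 ≤ t := (Nat.le_floor (by exact_mod_cast hT)).trans hTt
      have hlt := Nat.lt_floor_add_one (250 * (k * (β / δ) ^ 3))
      have hTt' : (⌊250 * (k * (β / δ) ^ 3)⌋₊ : ℝ) ≤ t := by exact_mod_cast hTt
      have hrate := h.sublinear_rate hf hβ hXs h2
      have ht0 : (0 : ℝ) < t := by exact_mod_cast ht
      have hlow : 72 * (k * (β / δ) ^ 3) ≤ t := by linarith
      have hlow' : 72 * k * β ^ 3 ≤ t * δ ^ 3 := by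
        have e : 72 * (k * (β / δ) ^ 3) = 72 * k * β ^ 3 / δ ^ 3 := by ring
        rwa [e, div_le_iff₀ (by positivity)] at hlow
      have ha := mul_le_mul_of_nonneg_left hrate (by positivity : 0 ≤ 18 * β ^ 2)
      refine le_of_mul_le_mul_right ?_ ht0
      nlinarith
  · intro t ht
    refine ⟨FantopeFW.rank_of_mem_projSet (h.linMin t ht).1, ?_⟩
    have hX := h.mem_fantope ht
    have ha := (h.linMin t ht).norm_sub_sq_le h1 hn hf hδ hXs hgap hX
    have hh : 0 ≤ f (X t) - f Xs := sub_nonneg.2 (hXs.2 hX)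
    have hb : 0 ≤ β ^ 2 / δ ^ 3 * (f (X t) - f Xs) := by positivity
    linarith
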